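/- Let $\lambda = 2\cos(\pi/5)$ and let $H_5$ be the subgroup of $SL(2,\mathbb{Z}[\lambda])$ generated by $S=\begin{pmatrix}0&1\\-1&0\end{pmatrix}$ and $T=\begin{pmatrix}1&\lambda\\0&1\end{pmatrix}$. For $a\in\mathbb{Z}[\lambda]$ let $H(a)=\{A\in H_5 : A\equiv I \pmod a\}$, where the congruence is entrywise modulo the ideal $(a)$. Let $Z=\langle\pm I\rangle$, let $G_5=H_5/Z$, and let $G(a)=H(a)Z/Z\subseteq G_5$. Then $G(2)/G(4)$ is an elementary abelian group of order $2^4$. Moreover, for every $\alpha\in\mathbb{Z}[\lambda]$ such that $\gcd(2,\alpha)=1$ and $(\alpha)\neq(1)$, the group $G(2\alpha)/G(4\alpha)$ is elementary abelian of order $2^5$. -/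

import Mathlib

noncomputable section

open scoped MatrixGroups

namespace HeckeFive

/-- The real number `λ = 2 cos (π / 5)`. -/
def lam : ℝ := 2 * Real.cos (Real.pi / 5)

/-- The ring `ℤ[λ]`, as a subring of `ℝ`. -/
abbrev ZLam : Subalgebra ℤ ℝ := Algebra.adjoin ℤ {lam}

/-- `λ` as an element of `ℤ[λ]`. -/
def lamZ : ZLam := ⟨lam, Algebra.self_mem_adjoin_singleton ℤ lam⟩

/-- The matrix `T = (1, λ; 0, 1)`. -/
def T : SL(2, ZLam) := ⟨!![1, lamZ; 0, 1], by simp [Matrix.det_fin_two]⟩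

/-- The matrix `S = (0, 1; -1, 0)`. -/
def S : SL(2, ZLam) := ⟨!![0, 1; -1, 0], by simp [Matrix.det_fin_two]⟩

/-- The homogeneous Hecke group `H₅ = ⟨S, T⟩`. -/
def H5 : Subgroup SL(2, ZLam) := Subgroup.closure {S, T}

/-- The principal congruence subgroup `H(a) = {A ∈ H₅ : A ≡ I (mod a)}`, as the kernel of
entrywise reduction modulo the ideal `(a)`; see `mem_H_iff`. -/
def H (a : ZLam) : Subgroup H5 :=
  ((Matrix.SpecialLinearGroup.map (n := Fin 2)
    (Ideal.Quotient.mk (Ideal.span {a}))).comp H5.subtype).ker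

instance H_normal (a : ZLam) : (H a).Normal := MonoidHom.normal_ker _

theorem mem_H_iff (a : ZLam) (A : H5) :
    A ∈ H a ↔ ∀ i j, a ∣ (A : SL(2, ZLam)) i j - (1 : Matrix (Fin 2) (Fin 2) ZLam) i j := by
  have key : ∀ x y : ZLam, Ideal.Quotient.mk (Ideal.span {a}) x =
      Ideal.Quotient.mk (Ideal.span {a}) y ↔ a ∣ x - y := fun x y => by
    rw [Ideal.Quotient.eq, Ideal.mem_span_singleton]
  have h1 : ∀ i j, ((1 : SL(2, ZLam ⧸ Ideal.span {a})) i j) =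
      Ideal.Quotient.mk (Ideal.span {a}) ((1 : Matrix (Fin 2) (Fin 2) ZLam) i j) := by
    intro i j
    by_cases h : i = j <;> simp [Matrix.one_apply, h]
  rw [H, MonoidHom.mem_ker, Matrix.SpecialLinearGroup.ext_iff]
  refine forall_congr' fun i => forall_congr' fun j => ?_
  rw [h1, ← key]
  rfl

theorem H_le_of_dvd {a b : ZLam} (h : a ∣ b) : H b ≤ H a := fun A hA => by
  rw [mem_H_iff] at hA ⊢
  exact fun i j => h.trans (hA i j)

theorem neg_one_mem_H5 : (-1 : SL(2, ZLam)) ∈ H5 := by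
  have h : S * S = -1 := by
    apply Subtype.ext
    change S.1 * S.1 = -1
    rw [Matrix.one_fin_two]
    simp [S]
  rw [← h]
  have hS : S ∈ H5 := Subgroup.subset_closure (by simp)
  exact H5.mul_mem hS hS

/-- The subgroup `Z = ⟨± I⟩` of `H₅`. -/
def Z : Subgroup H5 := Subgroup.zpowers ⟨-1, neg_one_mem_H5⟩

theorem Z_le_center : Z ≤ Subgroup.center H5 := by
  rw [Z, Subgroup.zpowers_le, Subgroup.mem_center_iff]
  intro g
  apply Subtype.ext
  simp

instance Z_normal : Z.Normal := by
  refine ⟨fun n hn g => ?_⟩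
  have h := Subgroup.mem_center_iff.mp (Z_le_center hn) g
  rwa [h, mul_inv_cancel_right]

/-- The inhomogeneous Hecke group `G₅ = H₅ / Z`. -/
abbrev G5 : Type := H5 ⧸ Z

/-- The principal congruence subgroup `G(a) = H(a) Z / Z` of `G₅`, the image of `H(a)`. -/
def G (a : ZLam) : Subgroup G5 := (H a).map (QuotientGroup.mk' Z)

instance G_normal (a : ZLam) : (G a).Normal :=
  (H_normal a).map _ (QuotientGroup.mk'_surjective Z)

theorem G_le_of_dvd {a b : ZLam} (h : a ∣ b) : G b ≤ G a := Subgroup.map_mono (H_le_of_dvd h)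

/-- The quotient group `G(a) / G(b)`. It is used only for `a ∣ b`, where `G(b) ≤ G(a)` by
`G_le_of_dvd`. -/
abbrev GQuot (a b : ZLam) : Type := G a ⧸ (G b).subgroupOf (G a)

/-- A group is elementary abelian of order `p ^ k` (with `p` a prime) if it is abelian, every
element is killed by `p`, and it has exactly `p ^ k` elements. -/
def IsElementaryAbelianOfOrder (p k : ℕ) (Q : Type) [Group Q] : Prop :=
  p.Prime ∧ (∀ x y : Q, x * y = y * x) ∧ (∀ x : Q, x ^ p = 1) ∧ Nat.card Q = p ^ k

end HeckeFive

end

open scoped MatrixGroups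

namespace HeckeFive

/-! ### Coordinates on `ℤ[λ]` -/

/-! Write `A ∈ H(2)` as `1 + 2X`. Then `A ↦ X mod 2` is additive with kernel `H(4)`, and its values
are matrices over `ℤ[λ]/2`, the field of four elements. Determinant one forces trace zero, which
leaves dimension 6 over the field of two elements. One more linear relation, `parityForm`, comes
from the dihedral image of `H₅` modulo 2: a Schreier-type check on ten representatives
(`dihedralReps_mul`) gives `parity_halfPart`. Hence the dimension is at most 5. Equality already
holds on `H(2a)` for `a` prime to 2 (`map_halfHom_eq_top`): conjugates of `T^(2k)`, with `k` an odd
multiple of `a`, map to a spanning set. It remains to account for `-1`, whose image is nonzero. It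
lies in `H(2)`, so one dimension is lost in `G(2)/G(4)`; it is not in `H(2a)` when `a` is not a
unit, so all five survive there. -/

theorem lam_eq_goldenRatio : lam = Real.goldenRatio := by
  rw [lam, Real.cos_pi_div_five, Real.goldenRatio]
  ring

theorem lam_mul_lam : lam * lam = lam + 1 := by
  rw [lam_eq_goldenRatio, ← sq, Real.goldenRatio_sq]

theorem lamZ_mul_lamZ : lamZ * lamZ = lamZ + 1 := Subtype.ext lam_mul_lam

/-- The ring `ℤ[ω]` with `ω ^ 2 = 1 + ω`, with computable arithmetic. -/
abbrev GoldenInt : Type := QuadraticAlgebra ℤ 1 1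

/-- The homomorphism `ℤ[ω] → ℤ[λ]` with `ω ↦ λ`. -/
noncomputable def goldenHom : GoldenInt →ₐ[ℤ] ZLam :=
  QuadraticAlgebra.lift ⟨lamZ, by rw [lamZ_mul_lamZ, one_smul, one_smul, add_comm]⟩

theorem goldenHom_apply (z : GoldenInt) : goldenHom z = (z.re : ZLam) + z.im * lamZ := by
  change z.re • (1 : ZLam) + z.im • lamZ = _
  simp

theorem goldenHom_injective : Function.Injective goldenHom := by
  rw [injective_iff_map_eq_zero]
  intro z hz
  rw [goldenHom_apply] at hz
  have h : (z.re : ℝ) + z.im * lam = 0 := by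
    have := congrArg (Subtype.val) hz
    simpa [lamZ] using this
  rw [lam_eq_goldenRatio] at h
  have him : z.im = 0 := by
    by_contra hne
    exact ((Real.goldenRatio_irrational.intCast_mul hne).intCast_add z.re).ne_zero h
  rw [him] at h
  have hre : z.re = 0 := by simpa using h
  exact QuadraticAlgebra.ext hre him

theorem goldenHom_surjective : Function.Surjective goldenHom := by
  rintro ⟨x, hx⟩
  have hle : Algebra.adjoin ℤ {lam} ≤ (ZLam.val.comp goldenHom).range := by
    rw [Algebra.adjoin_le_iff, Set.singleton_subset_iff]
    refine ⟨⟨0, 1⟩, ?_⟩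
    change ((goldenHom ⟨0, 1⟩ : ZLam) : ℝ) = lam
    rw [goldenHom_apply]
    simp [lamZ]
  obtain ⟨z, hz⟩ := hle hx
  exact ⟨z, Subtype.ext hz⟩

/-- The isomorphism sending `m + n λ` to the pair of its coordinates. -/
noncomputable def coords : ZLam ≃+* GoldenInt :=
  (RingEquiv.ofBijective goldenHom ⟨goldenHom_injective, goldenHom_surjective⟩).symm

theorem coords_lamZ : coords lamZ = ⟨0, 1⟩ := by
  rw [coords, RingEquiv.symm_apply_eq]
  change lamZ = goldenHom _
  rw [goldenHom_apply]
  simp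

theorem two_dvd_golden_iff (z : GoldenInt) : 2 ∣ z ↔ 2 ∣ z.re ∧ 2 ∣ z.im := by
  constructor
  · rintro ⟨w, rfl⟩
    rw [two_mul, QuadraticAlgebra.re_add, QuadraticAlgebra.im_add, ← two_mul, ← two_mul]
    exact ⟨dvd_mul_right _ _, dvd_mul_right _ _⟩
  · rintro ⟨⟨m, hm⟩, ⟨n, hn⟩⟩
    refine ⟨⟨m, n⟩, ?_⟩
    rw [two_mul]
    exact QuadraticAlgebra.ext (by rw [hm, two_mul]; rfl) (by rw [hn, two_mul]; rfl)

/-- The first coordinate modulo two. -/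
noncomputable def reTwo : ZLam →+ ZMod 2 where
  toFun x := ((coords x).re : ZMod 2)
  map_zero' := by simp
  map_add' x y := by simp

/-- The second coordinate modulo two. -/
noncomputable def imTwo : ZLam →+ ZMod 2 where
  toFun x := ((coords x).im : ZMod 2)
  map_zero' := by simp
  map_add' x y := by simp

theorem reTwo_apply (x : ZLam) : reTwo x = ((coords x).re : ZMod 2) := rfl

theorem imTwo_apply (x : ZLam) : imTwo x = ((coords x).im : ZMod 2) := rfl

theorem reTwo_mul (x y : ZLam) : reTwo (x * y) = reTwo x * reTwo y + imTwo x * imTwo y := by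
  simp [reTwo_apply, imTwo_apply]

theorem imTwo_mul (x y : ZLam) :
    imTwo (x * y) = reTwo x * imTwo y + imTwo x * reTwo y + imTwo x * imTwo y := by
  simp [reTwo_apply, imTwo_apply]

theorem reTwo_one : reTwo 1 = 1 := by
  simp [reTwo_apply, QuadraticAlgebra.re_one]

theorem imTwo_one : imTwo 1 = 0 := by
  simp [imTwo_apply, QuadraticAlgebra.im_one]

theorem reTwo_lamZ : reTwo lamZ = 0 := by
  simp [reTwo_apply, coords_lamZ]

theorem imTwo_lamZ : imTwo lamZ = 1 := by
  simp [imTwo_apply, coords_lamZ]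

theorem reTwo_intCast (n : ℤ) : reTwo (n : ZLam) = n := by
  simp [reTwo_apply]

theorem imTwo_intCast (n : ℤ) : imTwo (n : ZLam) = 0 := by
  simp [imTwo_apply]

theorem two_dvd_iff (x : ZLam) : 2 ∣ x ↔ reTwo x = 0 ∧ imTwo x = 0 := by
  rw [← map_dvd_iff coords, map_ofNat, two_dvd_golden_iff, reTwo_apply, imTwo_apply,
    ZMod.intCast_zmod_eq_zero_iff_dvd, ZMod.intCast_zmod_eq_zero_iff_dvd]
  rfl

theorem two_ne_zero_ZLam : (2 : ZLam) ≠ 0 := two_ne_zero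

theorem not_isUnit_two : ¬ IsUnit (2 : ZLam) := by
  rw [isUnit_iff_dvd_one, two_dvd_iff, reTwo_one]
  simp

/-- An element prime to the inert prime `2` has odd norm. -/
theorem exists_odd_dvd {a : ZLam} (ha : IsRelPrime 2 a) : ∃ n : ℤ, Odd n ∧ a ∣ (n : ZLam) := by
  have h2 : ¬ 2 ∣ a := fun h => not_isUnit_two (ha dvd_rfl h)
  obtain ⟨z, rfl⟩ := coords.symm.surjective a
  rw [← map_dvd_iff coords, map_ofNat, RingEquiv.apply_symm_apply, two_dvd_golden_iff] at h2
  -- This is the norm of `z`; it is even only if both coordinates are even.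
  refine ⟨z.re * z.re + z.re * z.im - z.im * z.im, ?_, ?_⟩
  · rw [← Int.not_even_iff_odd]
    rw [← even_iff_two_dvd, ← even_iff_two_dvd] at h2
    intro h
    apply h2
    simp only [Int.even_sub, Int.even_add, Int.even_mul] at h
    tauto
  · rw [← map_dvd_iff coords, RingEquiv.apply_symm_apply, map_intCast]
    -- The cofactor is the Galois conjugate of `z`, since `ω` has conjugate `1 - ω`.
    refine ⟨⟨z.re + z.im, -z.im⟩, QuadraticAlgebra.ext ?_ ?_⟩ <;> simp <;> ring

theorem isCoprime_two {a : ZLam} (ha : IsRelPrime 2 a) : IsCoprime 2 a := by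
  obtain ⟨n, ⟨k, rfl⟩, b, hb⟩ := exists_odd_dvd ha
  refine ⟨-(k : ZLam), b, ?_⟩
  push_cast at hb
  rw [mul_comm b, ← hb]
  ring

/-! ### The dihedral image of `H₅` modulo `2` -/

/-- Representatives for the reduction of `H₅` modulo `2`: the matrices `(TS)^i` and `(TS)^i S`
with `i < 5`. -/
def dihedralReps : List (Matrix (Fin 2) (Fin 2) GoldenInt) :=
  [!![⟨1, 0⟩, ⟨0, 0⟩; ⟨0, 0⟩, ⟨1, 0⟩], !![⟨0, -1⟩, ⟨1, 0⟩; ⟨-1, 0⟩, ⟨0, 0⟩],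
    !![⟨0, 1⟩, ⟨0, -1⟩; ⟨0, 1⟩, ⟨-1, 0⟩], !![⟨-1, 0⟩, ⟨0, 1⟩; ⟨0, -1⟩, ⟨0, 1⟩],
    !![⟨0, 0⟩, ⟨-1, 0⟩; ⟨1, 0⟩, ⟨0, -1⟩],
    !![⟨0, 0⟩, ⟨1, 0⟩; ⟨-1, 0⟩, ⟨0, 0⟩], !![⟨-1, 0⟩, ⟨0, -1⟩; ⟨0, 0⟩, ⟨-1, 0⟩],
    !![⟨0, 1⟩, ⟨0, 1⟩; ⟨1, 0⟩, ⟨0, 1⟩], !![⟨0, -1⟩, ⟨-1, 0⟩; ⟨0, -1⟩, ⟨0, -1⟩],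
    !![⟨1, 0⟩, ⟨0, 0⟩; ⟨0, 1⟩, ⟨1, 0⟩]]

/-- The images of `S`, `S⁻¹`, `T`, `T⁻¹`. -/
def heckeGens : List (Matrix (Fin 2) (Fin 2) GoldenInt) :=
  [!![⟨0, 0⟩, ⟨1, 0⟩; ⟨-1, 0⟩, ⟨0, 0⟩], !![⟨0, 0⟩, ⟨-1, 0⟩; ⟨1, 0⟩, ⟨0, 0⟩],
    !![⟨1, 0⟩, ⟨0, 1⟩; ⟨0, 0⟩, ⟨1, 0⟩], !![⟨1, 0⟩, ⟨0, -1⟩; ⟨0, 0⟩, ⟨1, 0⟩]]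

/-- The halved entry-wise coordinates of `M`. -/
def halfCoords (M : Matrix (Fin 2) (Fin 2) GoldenInt) : Matrix (Fin 2) (Fin 2) GoldenInt :=
  !![⟨(M 0 0).re / 2, (M 0 0).im / 2⟩, ⟨(M 0 1).re / 2, (M 0 1).im / 2⟩;
    ⟨(M 1 0).re / 2, (M 1 0).im / 2⟩, ⟨(M 1 1).re / 2, (M 1 1).im / 2⟩]

/-- The linear form on matrices over `ℤ[ω]` whose reduction modulo `2` vanishes on `X` whenever
`1 + 2 X` lies in `H₅`. -/
def parityForm (X : Matrix (Fin 2) (Fin 2) GoldenInt) : ℤ :=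
  (X 0 0).im + (X 0 1).re + (X 1 0).re

/-- The difference `g'⁻¹ s g - 1`, for matrices of determinant one. -/
def cocycle (g' s g : Matrix (Fin 2) (Fin 2) GoldenInt) : Matrix (Fin 2) (Fin 2) GoldenInt :=
  !![g' 1 1, -g' 0 1; -g' 1 0, g' 0 0] * (s * g) - 1

/-- A finite check of 40 products, the inductive step for words in the generators. With the
representative kept on the left, the parity form need not be shown invariant under conjugation. -/
theorem dihedralReps_mul :
    ∀ s ∈ heckeGens, ∀ g ∈ dihedralReps, ∃ g' ∈ dihedralReps,
      s * g = g' * (1 + (halfCoords (cocycle g' s g) + halfCoords (cocycle g' s g))) ∧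
        parityForm (halfCoords (cocycle g' s g)) % 2 = 0 := by
  decide

theorem eq_one_of_mem_dihedralReps :
    ∀ g ∈ dihedralReps, ((g 0 1).re % 2 = 0 ∧ (g 0 1).im % 2 = 0 ∧
      (g 1 0).re % 2 = 0 ∧ (g 1 0).im % 2 = 0) → g = 1 := by
  decide

theorem parityForm_add (X Y : Matrix (Fin 2) (Fin 2) GoldenInt) :
    parityForm (X + Y) = parityForm X + parityForm Y := by
  simp only [parityForm, Matrix.add_apply, QuadraticAlgebra.re_add, QuadraticAlgebra.im_add]
  ring

/-- The image of a matrix over `ℤ[λ]` in coordinates. -/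
noncomputable abbrev coordMatrix (A : Matrix (Fin 2) (Fin 2) ZLam) :
    Matrix (Fin 2) (Fin 2) GoldenInt :=
  coords.toRingHom.mapMatrix A

theorem coordMatrix_of (a b c d : ZLam) :
    coordMatrix !![a, b; c, d] = !![coords a, coords b; coords c, coords d] := by
  refine Matrix.ext fun i j => ?_
  fin_cases i <;> fin_cases j <;> rfl

theorem coe_S_inv : (S⁻¹).1 = !![0, -1; 1, 0] := by
  change S.1.adjugate = _
  simp [S, Matrix.adjugate_fin_two]

theorem coe_T_inv : (T⁻¹).1 = !![1, -lamZ; 0, 1] := by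
  change T.1.adjugate = _
  simp [T, Matrix.adjugate_fin_two]

theorem coordMatrix_mem_heckeGens {A : SL(2, ZLam)} (hA : A ∈ ({S, T} : Set SL(2, ZLam))) :
    coordMatrix A.1 ∈ heckeGens ∧ coordMatrix A⁻¹.1 ∈ heckeGens := by
  rcases hA with rfl | rfl
  · rw [coe_S_inv, S, coordMatrix_of, coordMatrix_of, map_neg, map_zero, map_one]
    decide
  · rw [coe_T_inv, T, coordMatrix_of, coordMatrix_of, map_neg, map_zero, map_one, coords_lamZ]
    decide

theorem exists_dihedral_decomposition {A : SL(2, ZLam)} (hA : A ∈ H5) :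
    ∃ g ∈ dihedralReps, ∃ X, coordMatrix A.1 = g * (1 + (X + X)) ∧ parityForm X % 2 = 0 := by
  have step : ∀ (s : SL(2, ZLam)), coordMatrix s.1 ∈ heckeGens → ∀ y : SL(2, ZLam),
      (∃ g ∈ dihedralReps, ∃ X, coordMatrix y.1 = g * (1 + (X + X)) ∧ parityForm X % 2 = 0) →
      ∃ g ∈ dihedralReps, ∃ X, coordMatrix (s * y).1 = g * (1 + (X + X)) ∧
        parityForm X % 2 = 0 := by
    rintro s hs y ⟨g, hg, X, hX, hpar⟩
    obtain ⟨g', hg', he, hpar'⟩ := dihedralReps_mul _ hs g hg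
    set Y := halfCoords (cocycle g' (coordMatrix s.1) g)
    -- The witness comes from `(1 + 2Y)(1 + 2X) = 1 + 2(X + Y + 2YX)`; the term `2YX` has even
    -- parity form.
    refine ⟨g', hg', X + Y + (Y * X + Y * X), ?_, ?_⟩
    · rw [Matrix.SpecialLinearGroup.coe_mul, coordMatrix, map_mul]
      change coordMatrix s.1 * coordMatrix y.1 = _
      rw [hX, ← mul_assoc, he]
      noncomm_ring
    · rw [parityForm_add, parityForm_add, parityForm_add]
      omega
  refine Subgroup.closure_induction_left (p := fun A _ => ∃ g ∈ dihedralReps, ∃ X,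
    coordMatrix A.1 = g * (1 + (X + X)) ∧ parityForm X % 2 = 0) ?_ ?_ ?_ hA
  · refine ⟨1, ?_, 0, ?_, rfl⟩
    · decide
    · simp [coordMatrix]
  · exact fun x hx y _ h => step x (coordMatrix_mem_heckeGens hx).1 y h
  · exact fun x hx y _ h => step _ (coordMatrix_mem_heckeGens hx).2 y h

/-! ### The homomorphism from `H(2)` -/

theorem mem_H_iff_exists (a : ZLam) (A : H5) :
    A ∈ H a ↔ ∃ X : Matrix (Fin 2) (Fin 2) ZLam, A.1.1 = 1 + a • X := by
  rw [mem_H_iff]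
  constructor
  · intro h
    choose X hX using h
    refine ⟨Matrix.of X, ?_⟩
    ext i j : 2
    rw [Matrix.add_apply, Matrix.smul_apply, Matrix.of_apply, smul_eq_mul, ← hX i j]
    exact (add_sub_cancel _ _).symm
  · rintro ⟨X, hX⟩ i j
    refine ⟨X i j, ?_⟩
    rw [hX, Matrix.add_apply, Matrix.smul_apply, smul_eq_mul, add_sub_cancel_left]

/-- The matrix `(A - 1) / 2` for `A ∈ H(2)`. -/
noncomputable def halfPart (A : H 2) : Matrix (Fin 2) (Fin 2) ZLam :=
  ((mem_H_iff_exists 2 A.1).mp A.2).choose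

theorem halfPart_spec (A : H 2) : A.1.1.1 = 1 + (2 : ZLam) • halfPart A :=
  ((mem_H_iff_exists 2 A.1).mp A.2).choose_spec

theorem halfPart_eq {A : H 2} {X : Matrix (Fin 2) (Fin 2) ZLam}
    (h : A.1.1.1 = 1 + (2 : ZLam) • X) : halfPart A = X := by
  rw [halfPart_spec, add_right_inj] at h
  exact smul_right_injective _ two_ne_zero_ZLam h

theorem halfPart_one : halfPart 1 = 0 := halfPart_eq (by simp)

theorem halfPart_mul (A B : H 2) : halfPart (A * B) =
    halfPart A + halfPart B + (2 : ZLam) • (halfPart A * halfPart B) := by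
  apply halfPart_eq
  change A.1.1.1 * B.1.1.1 = _
  rw [halfPart_spec, halfPart_spec B]
  simp only [mul_add, add_mul, smul_add, smul_mul_assoc, mul_smul_comm, one_mul, mul_one]
  abel

/-- For `A ≡ 1` modulo 2 the dihedral representative must be `1`, so the decomposition of `A`
exhibits `(A - 1) / 2` itself as the matrix of even parity. -/
theorem parity_halfPart (A : H 2) :
    imTwo (halfPart A 0 0) + reTwo (halfPart A 0 1) + reTwo (halfPart A 1 0) = 0 := by
  obtain ⟨g, hg, X, hX, hpar⟩ := exists_dihedral_decomposition A.1.2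
  have hY : coordMatrix A.1.1.1 = 1 + (coordMatrix (halfPart A) + coordMatrix (halfPart A)) := by
    rw [halfPart_spec, two_smul]
    simp only [coordMatrix, map_add, map_one]
  rw [hY] at hX
  set Y := coordMatrix (halfPart A) with hYdef
  have hg1 : g = 1 := by
    apply eq_one_of_mem_dihedralReps g hg
    have hgX : g = 1 + ((Y - g * X) + (Y - g * X)) := by
      calc g = g * (1 + (X + X)) - (g * X + g * X) := by noncomm_ring
        _ = 1 + (Y + Y) - (g * X + g * X) := by rw [← hX]
        _ = _ := by abel
    have h01 := congrFun (congrFun hgX 0) 1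
    have h10 := congrFun (congrFun hgX 1) 0
    generalize Y - g * X = W at h01 h10
    rw [h01, h10]
    simp only [Matrix.add_apply, QuadraticAlgebra.re_add, QuadraticAlgebra.im_add,
      Matrix.one_apply_ne (show (0 : Fin 2) ≠ 1 by decide),
      Matrix.one_apply_ne (show (1 : Fin 2) ≠ 0 by decide), QuadraticAlgebra.re_zero,
      QuadraticAlgebra.im_zero]
    omega
  rw [hg1, one_mul, add_right_inj, ← two_smul ℤ, ← two_smul ℤ] at hX
  have hYX : Y = X := smul_right_injective _ (two_ne_zero (α := ℤ)) hX
  rw [← hYX] at hpar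
  rw [imTwo_apply, reTwo_apply, reTwo_apply, ← Int.cast_add, ← Int.cast_add,
    ZMod.intCast_zmod_eq_zero_iff_dvd]
  exact Int.dvd_of_emod_eq_zero hpar

/-- Modulo `2`, the matrix `(A - 1) / 2` has trace zero. -/
theorem two_dvd_trace_halfPart (A : H 2) : 2 ∣ halfPart A 0 0 + halfPart A 1 1 := by
  have hdet := A.1.1.2
  rw [halfPart_spec, Matrix.det_fin_two] at hdet
  simp only [Matrix.add_apply, Matrix.smul_apply, Matrix.one_apply_eq, smul_eq_mul,
    Matrix.one_apply_ne (show (0 : Fin 2) ≠ 1 by decide),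
    Matrix.one_apply_ne (show (1 : Fin 2) ≠ 0 by decide)] at hdet
  -- From `det (1 + 2X) = 1 + 2 tr X + 4 det X = 1` it follows that `tr X = -2 det X`.
  refine ⟨halfPart A 0 1 * halfPart A 1 0 - halfPart A 0 0 * halfPart A 1 1, ?_⟩
  apply mul_left_cancel₀ two_ne_zero_ZLam
  linear_combination hdet

theorem reTwo_two_mul (x : ZLam) : reTwo (2 * x) = 0 :=
  ((two_dvd_iff _).mp (dvd_mul_right 2 x)).1

theorem imTwo_two_mul (x : ZLam) : imTwo (2 * x) = 0 :=
  ((two_dvd_iff _).mp (dvd_mul_right 2 x)).2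

/-- Five of the coordinates modulo `2` of a matrix over `ℤ[λ]`. -/
noncomputable def fiveCoords (X : Matrix (Fin 2) (Fin 2) ZLam) : Fin 5 → ZMod 2 :=
  ![reTwo (X 0 0), imTwo (X 0 0), reTwo (X 0 1), imTwo (X 0 1), imTwo (X 1 0)]

/-- The homomorphism `A ↦ (A - 1) / 2 mod 2` on `H(2)`, in coordinates. -/
noncomputable def halfHom : H 2 →* Multiplicative (Fin 5 → ZMod 2) where
  toFun A := Multiplicative.ofAdd (fiveCoords (halfPart A))
  map_one' := by
    rw [halfPart_one, ← ofAdd_zero]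
    congr 1
    ext i
    fin_cases i <;> simp [fiveCoords]
  map_mul' A B := by
    rw [halfPart_mul, ← ofAdd_add]
    congr 1
    ext i
    fin_cases i <;> simp [fiveCoords, reTwo_two_mul, imTwo_two_mul]

theorem halfHom_apply (A : H 2) : halfHom A = Multiplicative.ofAdd (fiveCoords (halfPart A)) := rfl

/-- The five coordinates suffice: parity recovers `reTwo` of the lower left entry, and the trace
relation recovers the lower right entry modulo 2. -/
theorem halfHom_eq_one_iff (A : H 2) : halfHom A = 1 ↔ A.1 ∈ H 4 := by
  have h4 : A.1 ∈ H 4 ↔ ∀ i j, 2 ∣ halfPart A i j := by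
    rw [mem_H_iff]
    refine forall_congr' fun i => forall_congr' fun j => ?_
    have : (A.1.1 : Matrix (Fin 2) (Fin 2) ZLam) i j - (1 : Matrix (Fin 2) (Fin 2) ZLam) i j =
        2 * halfPart A i j := by
      rw [halfPart_spec, Matrix.add_apply, Matrix.smul_apply, smul_eq_mul, add_sub_cancel_left]
    change (4 : ZLam) ∣ (A.1.1 : Matrix (Fin 2) (Fin 2) ZLam) i j - _ ↔ _
    rw [this, show (4 : ZLam) = 2 * 2 by norm_num, mul_dvd_mul_iff_left two_ne_zero_ZLam]
  rw [h4, halfHom_apply, ofAdd_eq_one]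
  have hpar := parity_halfPart A
  have htr := two_dvd_trace_halfPart A
  constructor
  · intro h
    have c0 : reTwo (halfPart A 0 0) = 0 := congrFun h 0
    have c1 : imTwo (halfPart A 0 0) = 0 := congrFun h 1
    have c2 : reTwo (halfPart A 0 1) = 0 := congrFun h 2
    have c3 : imTwo (halfPart A 0 1) = 0 := congrFun h 3
    have c4 : imTwo (halfPart A 1 0) = 0 := congrFun h 4
    rw [c1, c2, zero_add, zero_add] at hpar
    have h00 : 2 ∣ halfPart A 0 0 := (two_dvd_iff _).mpr ⟨c0, c1⟩
    rw [Fin.forall_fin_two, Fin.forall_fin_two, Fin.forall_fin_two]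
    exact ⟨⟨h00, (two_dvd_iff _).mpr ⟨c2, c3⟩⟩, (two_dvd_iff _).mpr ⟨hpar, c4⟩,
      (dvd_add_right h00).mp htr⟩
  · intro h
    simp only [two_dvd_iff] at h
    ext i
    fin_cases i
    exacts [(h 0 0).1, (h 0 0).2, (h 0 1).1, (h 0 1).2, (h 1 0).2]

/-! ### Parabolic elements of `H(2a)` -/

theorem coe_T_pow (k : ℕ) : (T ^ k).1 = !![1, k * lamZ; 0, 1] := by
  induction k with
  | zero => simp [Matrix.one_fin_two]
  | succ k ih =>
    rw [pow_succ]
    change (T ^ k).1 * T.1 = _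
    rw [ih, T]
    simp [add_mul, add_comm]

/-- Conjugates of even powers of `T`. -/
theorem coe_conj_T_pow (g : SL(2, ZLam)) (k : ℕ) :
    (g * T ^ (2 * k) * g⁻¹).1 = 1 + (2 : ZLam) • (((k : ZLam) * lamZ) •
      !![-(g.1 0 0 * g.1 1 0), g.1 0 0 * g.1 0 0; -(g.1 1 0 * g.1 1 0), g.1 0 0 * g.1 1 0]) := by
  have hdet := g.2
  rw [Matrix.det_fin_two] at hdet
  change g.1 * (T ^ (2 * k)).1 * g.1.adjugate = _
  rw [coe_T_pow, Matrix.adjugate_fin_two, Matrix.eta_fin_two g.1, Matrix.one_fin_two]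
  generalize g.1 0 0 = p, g.1 0 1 = q, g.1 1 0 = r, g.1 1 1 = s at *
  refine Matrix.ext fun i j => ?_
  fin_cases i <;> fin_cases j <;> simp [Matrix.mul_apply, Fin.sum_univ_two]
  · linear_combination hdet
  · ring
  · ring
  · linear_combination hdet

theorem T_mem_H5 : T ∈ H5 := Subgroup.subset_closure (by simp)

theorem S_mem_H5 : S ∈ H5 := Subgroup.subset_closure (by simp)

/-- The element is `g T^(2k) g⁻¹`. Only the first column of `g` matters, that is, the cusp to which
`g` sends infinity. -/
theorem exists_parabolic {a : ZLam} {k : ℕ} (hk : a ∣ (k : ZLam)) {g : SL(2, ZLam)} (hg : g ∈ H5) :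
    ∃ A : H 2, A.1 ∈ H (2 * a) ∧ halfPart A = ((k : ZLam) * lamZ) •
      !![-(g.1 0 0 * g.1 1 0), g.1 0 0 * g.1 0 0; -(g.1 1 0 * g.1 1 0), g.1 0 0 * g.1 1 0] := by
  obtain ⟨b, hb⟩ := hk
  have hmem : g * T ^ (2 * k) * g⁻¹ ∈ H5 :=
    H5.mul_mem (H5.mul_mem hg (H5.pow_mem T_mem_H5 _)) (H5.inv_mem hg)
  have ha : (⟨_, hmem⟩ : H5) ∈ H (2 * a) := by
    rw [mem_H_iff_exists]
    refine ⟨(b * lamZ) • !![-(g.1 0 0 * g.1 1 0), g.1 0 0 * g.1 0 0;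
      -(g.1 1 0 * g.1 1 0), g.1 0 0 * g.1 1 0], ?_⟩
    rw [coe_conj_T_pow, hb, smul_smul, smul_smul]
    congr 2
    ring
  refine ⟨⟨_, H_le_of_dvd (dvd_mul_right 2 a) ha⟩, ha, ?_⟩
  exact halfPart_eq (coe_conj_T_pow g k)

/-- `H(2a)` surjects onto the image of `H(2)` when `a` is prime to `2`. -/
theorem map_halfHom_eq_top {a : ZLam} (ha : IsRelPrime 2 a) :
    ((H (2 * a)).subgroupOf (H 2)).map halfHom = ⊤ := by
  obtain ⟨n, hn, hdvd⟩ := exists_odd_dvd ha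
  obtain ⟨k, hk, hdvd⟩ : ∃ k : ℕ, Odd k ∧ a ∣ (k : ZLam) := by
    refine ⟨n.natAbs, Int.natAbs_odd.mpr hn, ?_⟩
    rw [← Int.cast_natCast, Int.natCast_natAbs]
    rcases abs_choice n with h | h <;> rw [h]
    · exact hdvd
    · rw [Int.cast_neg]
      exact (dvd_neg).mpr hdvd
  set W := ((H (2 * a)).subgroupOf (H 2)).map halfHom
  have hk1 : (k : ZMod 2) = 1 := ZMod.natCast_eq_one_iff_odd.mpr hk
  have hre : reTwo (k : ZLam) = 1 := by
    rw [← Int.cast_natCast, reTwo_intCast, Int.cast_natCast, hk1]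
  have him : imTwo (k : ZLam) = 0 := by
    rw [← Int.cast_natCast, imTwo_intCast]
  have key : ∀ g ∈ H5, Multiplicative.ofAdd (fiveCoords (((k : ZLam) * lamZ) •
      !![-(g.1 0 0 * g.1 1 0), g.1 0 0 * g.1 0 0;
        -(g.1 1 0 * g.1 1 0), g.1 0 0 * g.1 1 0])) ∈ W := by
    intro g hg
    obtain ⟨A, hA, hX⟩ := exists_parabolic hdvd hg
    rw [← hX]
    exact ⟨A, hA, rfl⟩
  have hTS : T * S ∈ H5 := H5.mul_mem T_mem_H5 S_mem_H5
  have hTS_col : ∀ g : SL(2, ZLam), (T * S * g).1 0 0 = -lamZ * g.1 0 0 + g.1 1 0 ∧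
      (T * S * g).1 1 0 = -g.1 0 0 := by
    intro g
    change (T.1 * S.1 * g.1) 0 0 = _ ∧ (T.1 * S.1 * g.1) 1 0 = _
    simp [T, S, Matrix.mul_apply, Fin.sum_univ_two]
  -- The first columns of `1`, `TS`, `(TS)^2`, `(TS)^3` and `S` reduce to the five points of the
  -- projective line over the field of four elements. As `k` is odd, each image is the same as for
  -- `k = 1`.
  have h0 : Multiplicative.ofAdd ![0, 0, 0, 1, 0] ∈ W := by
    convert key 1 H5.one_mem using 2
    ext i
    fin_cases i <;> simp [fiveCoords, reTwo_mul, imTwo_mul, hre, him, reTwo_lamZ, imTwo_lamZ]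
  have h1 : Multiplicative.ofAdd ![1, 1, 1, 0, 1] ∈ W := by
    convert key (T * S * 1) (H5.mul_mem hTS H5.one_mem) using 2
    simp only [hTS_col]
    ext i
    fin_cases i <;> simp [fiveCoords, reTwo_mul, imTwo_mul, hre, him, reTwo_lamZ, imTwo_lamZ]
    rfl
  have h2 : Multiplicative.ofAdd ![1, 0, 1, 0, 0] ∈ W := by
    convert key (T * S * (T * S * 1)) (H5.mul_mem hTS (H5.mul_mem hTS H5.one_mem)) using 2
    simp only [hTS_col]
    ext i
    fin_cases i <;> simp [fiveCoords, reTwo_mul, imTwo_mul, hre, him, reTwo_lamZ, imTwo_lamZ,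
      reTwo_one, imTwo_one] <;> rfl
  have h3 : Multiplicative.ofAdd ![1, 1, 0, 1, 0] ∈ W := by
    convert key (T * S * (T * S * (T * S * 1)))
      (H5.mul_mem hTS (H5.mul_mem hTS (H5.mul_mem hTS H5.one_mem))) using 2
    simp only [hTS_col]
    ext i
    fin_cases i <;> simp [fiveCoords, reTwo_mul, imTwo_mul, hre, him, reTwo_lamZ, imTwo_lamZ,
      reTwo_one, imTwo_one] <;> rfl
  have h4 : Multiplicative.ofAdd ![0, 0, 0, 0, 1] ∈ W := by
    convert key S S_mem_H5 using 2
    ext i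
    fin_cases i <;> simp [S, fiveCoords, imTwo_mul, hre, him, reTwo_lamZ, imTwo_lamZ]
  rw [eq_top_iff]
  intro v _
  -- The five vectors form a basis; the coefficients are its dual basis.
  have hv : ∀ v : Fin 5 → ZMod 2, v = (v 3 + v 0 + v 2).val • ![0, 0, 0, 1, 0] +
      (v 0 + v 1 + v 2).val • ![1, 1, 1, 0, 1] + (v 0 + v 1).val • ![1, 0, 1, 0, 0] +
      (v 0 + v 2).val • ![1, 1, 0, 1, 0] + (v 4 + v 0 + v 1 + v 2).val • ![0, 0, 0, 0, 1] := by
    decide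
  rw [← ofAdd_toAdd v, hv (Multiplicative.toAdd v)]
  simp only [ofAdd_add, ofAdd_nsmul]
  exact W.mul_mem (W.mul_mem (W.mul_mem (W.mul_mem (W.pow_mem h0 _) (W.pow_mem h1 _))
    (W.pow_mem h2 _)) (W.pow_mem h3 _)) (W.pow_mem h4 _)

/-! ### The quotients `G(a) / G(b)` -/

theorem mem_Z_iff (A : H5) : A ∈ Z ↔ A = 1 ∨ A = ⟨-1, neg_one_mem_H5⟩ := by
  have hsq : (⟨-1, neg_one_mem_H5⟩ : H5) ^ 2 = 1 := Subtype.ext (by simp)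
  rw [Z, Subgroup.mem_zpowers_iff]
  constructor
  · rintro ⟨n, rfl⟩
    rcases Int.even_or_odd' n with ⟨m, rfl | rfl⟩
    · left
      rw [zpow_mul, zpow_ofNat, hsq, one_zpow]
    · right
      rw [zpow_add, zpow_mul, zpow_ofNat, hsq, one_zpow, one_mul, zpow_one]
  · rintro (rfl | rfl)
    · exact ⟨0, zpow_zero _⟩
    · exact ⟨1, zpow_one _⟩

theorem mk_mem_G_iff (b : ZLam) (A : H5) :
    QuotientGroup.mk' Z A ∈ G b ↔ A ∈ H b ∨ ⟨-1, neg_one_mem_H5⟩ * A ∈ H b := by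
  constructor
  · rintro ⟨B, hB, h⟩
    rw [QuotientGroup.mk'_eq_mk'] at h
    obtain ⟨z, hz, rfl⟩ := h
    rcases (mem_Z_iff z).mp hz with rfl | rfl
    · exact Or.inl (by rw [mul_one]; exact hB)
    · refine Or.inr ?_
      have h : ⟨-1, neg_one_mem_H5⟩ * (B * ⟨-1, neg_one_mem_H5⟩) = B := by
        refine Subtype.ext ?_
        change -1 * (B.1 * -1) = B.1
        simp
      rw [h]
      exact hB
  · rintro (h | h)
    · exact ⟨A, h, rfl⟩
    · refine ⟨_, h, ?_⟩
      rw [QuotientGroup.mk'_eq_mk']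
      refine ⟨⟨-1, neg_one_mem_H5⟩, (mem_Z_iff _).mpr (Or.inr rfl), Subtype.ext ?_⟩
      change (-1 * A.1) * -1 = A.1
      simp

/-- The preimage of `G(b)` in `H₅` is `H(b) ∪ -H(b)`, so `f` and the projection of `H(a)` onto
`G(a)/G(b)` are surjections with the same kernel. -/
theorem nonempty_GQuot_mulEquiv {a b : ZLam} {M : Type*} [Group M] (f : H a →* M)
    (hf : Function.Surjective f)
    (hker : ∀ A : H a, f A = 1 ↔ A.1 ∈ H b ∨ ⟨-1, neg_one_mem_H5⟩ * A.1 ∈ H b) :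
    Nonempty (GQuot a b ≃* M) := by
  let p : H a →* G a := (QuotientGroup.mk' Z).subgroupMap (H a)
  let q : H a →* GQuot a b := (QuotientGroup.mk' _).comp p
  have hq : Function.Surjective q :=
    (QuotientGroup.mk'_surjective _).comp (MonoidHom.subgroupMap_surjective _ _)
  have hkq : q.ker = f.ker := by
    ext A
    rw [MonoidHom.mem_ker, MonoidHom.mem_ker, hker, ← mk_mem_G_iff]
    change (QuotientGroup.mk (p A) : GQuot a b) = 1 ↔ _
    rw [QuotientGroup.eq_one_iff, Subgroup.mem_subgroupOf]
    rfl
  exact ⟨(QuotientGroup.quotientKerEquivOfSurjective q hq).symm.trans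
    ((QuotientGroup.quotientMulEquivOfEq hkq).trans
      (QuotientGroup.quotientKerEquivOfSurjective f hf))⟩

theorem IsElementaryAbelianOfOrder.of_mulEquiv {k : ℕ} {Q : Type} [Group Q]
    (e : Q ≃* Multiplicative (Fin k → ZMod 2)) : IsElementaryAbelianOfOrder 2 k Q := by
  refine ⟨Nat.prime_two, fun x y => e.injective ?_, fun x => e.injective ?_, ?_⟩
  · rw [map_mul, map_mul, mul_comm]
  · rw [map_pow, map_one, sq]
    exact funext fun i => CharTwo.add_self_eq_zero (Multiplicative.toAdd (e x) i)
  · rw [Nat.card_congr e.toEquiv, Nat.card_congr Multiplicative.toAdd]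
    simp

/-- Dropping the first coordinate. -/
def tailHom : Multiplicative (Fin 5 → ZMod 2) →* Multiplicative (Fin 4 → ZMod 2) where
  toFun v := Multiplicative.ofAdd (Fin.tail (Multiplicative.toAdd v))
  map_one' := rfl
  map_mul' _ _ := rfl

theorem tailHom_surjective : Function.Surjective tailHom := fun v =>
  ⟨Multiplicative.ofAdd (Fin.cons 0 (Multiplicative.toAdd v)), rfl⟩

/-- The vector `(1, 0, 0, 0, 0)` is the image of `-1` under `halfHom`, so `tailHom` divides out
exactly the sign. -/
theorem tailHom_eq_one_iff (v : Multiplicative (Fin 5 → ZMod 2)) :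
    tailHom v = 1 ↔ v = 1 ∨ Multiplicative.ofAdd ![1, 0, 0, 0, 0] * v = 1 := by
  revert v
  change ∀ v : Fin 5 → ZMod 2, Fin.tail v = 0 ↔ v = 0 ∨ ![1, 0, 0, 0, 0] + v = 0
  decide

theorem neg_one_mem_H_two : ⟨-1, neg_one_mem_H5⟩ ∈ H 2 := by
  rw [mem_H_iff_exists]
  refine ⟨-1, ?_⟩
  change (-1 : Matrix (Fin 2) (Fin 2) ZLam) = _
  rw [two_smul]
  abel

theorem halfHom_neg_one :
    halfHom ⟨_, neg_one_mem_H_two⟩ = Multiplicative.ofAdd ![1, 0, 0, 0, 0] := by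
  have h : halfPart ⟨_, neg_one_mem_H_two⟩ = -1 := by
    apply halfPart_eq
    change (-1 : Matrix (Fin 2) (Fin 2) ZLam) = _
    rw [two_smul]
    abel
  rw [halfHom_apply, h]
  congr 1
  ext i
  fin_cases i <;> simp [fiveCoords, reTwo_one, imTwo_one]

theorem isElementaryAbelian_GQuot_two_four : IsElementaryAbelianOfOrder 2 4 (GQuot 2 4) := by
  have hsurj : Function.Surjective halfHom := by
    -- Surjectivity on `H(2)` is the case `a = 1`.
    rw [← MonoidHom.range_eq_top, eq_top_iff, ← map_halfHom_eq_top isRelPrime_one_right]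
    exact Subgroup.map_le_range _ _
  obtain ⟨e⟩ := nonempty_GQuot_mulEquiv (b := 4) (tailHom.comp halfHom)
    (tailHom_surjective.comp hsurj) fun A => by
      rw [MonoidHom.comp_apply, tailHom_eq_one_iff, ← halfHom_neg_one, ← map_mul,
        halfHom_eq_one_iff, halfHom_eq_one_iff]
      rfl
  exact .of_mulEquiv e

theorem isElementaryAbelian_GQuot_mul {a : ZLam} (ha : IsRelPrime 2 a) (hu : ¬ IsUnit a) :
    IsElementaryAbelianOfOrder 2 5 (GQuot (2 * a) (4 * a)) := by
  have hle : H (2 * a) ≤ H 2 := H_le_of_dvd (dvd_mul_right 2 a)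
  have hsurj : Function.Surjective (halfHom.comp (Subgroup.inclusion hle)) := by
    intro v
    obtain ⟨A, hA, rfl⟩ : v ∈ ((H (2 * a)).subgroupOf (H 2)).map halfHom := by
      rw [map_halfHom_eq_top ha]
      trivial
    exact ⟨⟨A.1, hA⟩, rfl⟩
  obtain ⟨e⟩ := nonempty_GQuot_mulEquiv (b := 4 * a) _ hsurj fun A => by
    rw [MonoidHom.comp_apply, halfHom_eq_one_iff, or_iff_left]
    · constructor
      -- An entry of `A - 1` is `2ay`; divisibility by 4 gives `2 ∣ ay`, and coprimality gives `2 ∣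
      -- y`.
      · intro h4
        have h2a := A.2
        rw [mem_H_iff] at h4 h2a ⊢
        intro i j
        obtain ⟨y, hy⟩ := h2a i j
        have h4 := h4 i j
        change (4 : ZLam) ∣ (A.1.1 i j - (1 : Matrix (Fin 2) (Fin 2) ZLam) i j) at h4
        rw [hy, show (4 : ZLam) = 2 * 2 by norm_num, mul_assoc 2 a y,
          mul_dvd_mul_iff_left two_ne_zero_ZLam] at h4
        obtain ⟨z, rfl⟩ := (isCoprime_two ha).dvd_of_dvd_mul_left h4
        exact ⟨z, by rw [hy]; ring⟩
      · exact fun h => H_le_of_dvd (dvd_mul_right 4 a) h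
    -- If `-A ∈ H(4a)` with `A ∈ H(2a)`, then `-1 ∈ H(2a)`; hence `2a ∣ -2` and `a` is a unit.
    · intro h
      have h2 : ⟨-1, neg_one_mem_H5⟩ ∈ H (2 * a) := by
        have h3 := H_le_of_dvd (mul_dvd_mul_right (⟨2, by norm_num⟩ : (2 : ZLam) ∣ 4) a) h
        exact (Subgroup.mul_mem_cancel_right _ A.2).mp h3
      have h3 := (mem_H_iff _ _).mp h2 0 0
      apply hu
      rw [isUnit_iff_dvd_one, ← mul_dvd_mul_iff_left two_ne_zero_ZLam, ← dvd_neg]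
      convert h3 using 1
      simp
      norm_num
  exact .of_mulEquiv e

end HeckeFive

theorem lemma2p3 :
    HeckeFive.IsElementaryAbelianOfOrder 2 4 (HeckeFive.GQuot 2 4) ∧
    ∀ a : HeckeFive.ZLam, IsRelPrime 2 a → ¬ IsUnit a →
      HeckeFive.IsElementaryAbelianOfOrder 2 5 (HeckeFive.GQuot (2 * a) (4 * a)) :=
  ⟨HeckeFive.isElementaryAbelian_GQuot_two_four,
    fun _ ha hu => HeckeFive.isElementaryAbelian_GQuot_mul ha hu⟩
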